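/- Let $p_G$ and $p_{\mathrm{data}}$ be Borel probability measures on $\mathbb{R}^n$ with finite first moments (the generated and the data distribution). Let $\pi^*$ be an optimal transport plan from $p_G$ to $p_{\mathrm{data}}$ for $W_1(p_G,p_{\mathrm{data}})=\inf_{\pi\in\Pi(p_G,p_{\mathrm{data}})}\mathbb{E}_{(x,y)\sim\pi}\|x-y\|_2$, where $\Pi(p_G,p_{\mathrm{data}})$ is the set of couplings, and let $D^*:\mathbb{R}^n\to\mathbb{R}$ be an optimal critic, i.e. a maximizer of $\mathbb{E}_{p_{\mathrm{data}}}[f]-\mathbb{E}_{p_G}[f]$ over all functions $f$ that are $1$-Lipschitz for $\|\cdot\|_2$. For $x\in\mathbb{R}^n$ let $$A(x)=\operatorname*{arg\,min}_{y}\{\|y-x\|_2-D^*(y)\}$$ be the set of all global minimizers. Call a distribution $p_{ot}$ *admissible* if it is the law of $y_x$ where $x\sim p_G$ and, given $x$, the point $y_x$ is chosen, possibly at random, in $A(x)$; that is, $p_{ot}=\int \kappa(x,\cdot)\,p_G(dx)$ for a Markov kernel $\kappa$ such that $\kappa(x,\cdot)$ is concentrated on $A(x)$ for $p_G$-almost every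 $x$. Call $p_{ot}$ *admissible with a single-valued map* if $\kappa(x,\cdot)=\delta_{y_x}$ can be taken, i.e. if $p_{ot}$ is the push-forward of $p_G$ under a measurable map $x\mapsto y_x$ with $y_x\in A(x)$ for $p_G$-almost every $x$. Suppose that $p_{\mathrm{data}}\neq p_G$. Then: 1. For $\pi^*$-almost every $(x,y)$, every point $z$ of the segment from $x$ to $y$ lies in $A(x)$. If moreover $z\neq x$, and either $z\neq y$ or $D^*$ is differentiable at $z$, then $z$ is a stationary point: the function $w\mapsto\|w-x\|_2-D^*(w)$ is differentiable at $z$ with gradient $0$. 2. The minimizer is not unique: it is not the case that $A(x)$ has at most one element for $p_G$-almost every $x$. 3. There are infinitely many admissible distributions $p_{ot}$, and even infinitely many that are admissible with a single-valued map. 4. $p_{\mathrm{data}}$ is admissible. If $\pi^*$ is the law of $(x,T(x))$, $x\sim p_G$, for some measurable map $T$, then $p_{\mathrm{data}}$ is admissible with a single-valued map. -/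

import Mathlib

open MeasureTheory ProbabilityTheory

/-- `π` is a transport plan (coupling) from `μ` to `ν`: a measure on the product space
whose marginals are `μ` and `ν`. -/
def IsTransportPlan {n : ℕ}
    (π : Measure (EuclideanSpace ℝ (Fin n) × EuclideanSpace ℝ (Fin n)))
    (μ ν : Measure (EuclideanSpace ℝ (Fin n))) : Prop :=
  π.map Prod.fst = μ ∧ π.map Prod.snd = ν

/-- The transport cost of `π`, i.e. the expected Euclidean distance of `(x, y) ∼ π`. -/
noncomputable def transportCost {n : ℕ}
    (π : Measure (EuclideanSpace ℝ (Fin n) × EuclideanSpace ℝ (Fin n))) : ENNReal :=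
  ∫⁻ p, ENNReal.ofReal ‖p.1 - p.2‖ ∂π

/-- The first-order Wasserstein distance, in its primal form. -/
noncomputable def wasserstein1 {n : ℕ} (μ ν : Measure (EuclideanSpace ℝ (Fin n))) : ENNReal :=
  ⨅ (π : Measure (EuclideanSpace ℝ (Fin n) × EuclideanSpace ℝ (Fin n)))
    (_ : IsTransportPlan π μ ν), transportCost π

/-- `π` is an optimal transport plan: a solution of the primal problem. -/
def IsOptimalPlan {n : ℕ}
    (π : Measure (EuclideanSpace ℝ (Fin n) × EuclideanSpace ℝ (Fin n)))
    (μ ν : Measure (EuclideanSpace ℝ (Fin n))) : Prop :=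
  IsTransportPlan π μ ν ∧ transportCost π = wasserstein1 μ ν

/-- `D` is an optimal critic for the generated distribution `pG` and the data distribution
`pData`: it solves the Kantorovich-Rubinstein dual problem of maximizing
`E_{pData} f - E_{pG} f` over all functions `f` that are 1-Lipschitz for the Euclidean norm. -/
def IsOptimalCritic {n : ℕ} (D : EuclideanSpace ℝ (Fin n) → ℝ)
    (pG pData : Measure (EuclideanSpace ℝ (Fin n))) : Prop :=
  LipschitzWith 1 D ∧
    ∀ f : EuclideanSpace ℝ (Fin n) → ℝ, LipschitzWith 1 f →
      (∫ x, f x ∂pData) - (∫ x, f x ∂pG) ≤ (∫ x, D x ∂pData) - (∫ x, D x ∂pG)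

/-- The objective `y ↦ ‖y - x‖ - D y` of discriminator optimal transport (DOT). -/
noncomputable def dotObjective {n : ℕ} (D : EuclideanSpace ℝ (Fin n) → ℝ)
    (x y : EuclideanSpace ℝ (Fin n)) : ℝ :=
  ‖y - x‖ - D y

/-- The set of all global minimizers of the DOT objective at `x`. -/
def dotArgmin {n : ℕ} (D : EuclideanSpace ℝ (Fin n) → ℝ)
    (x : EuclideanSpace ℝ (Fin n)) : Set (EuclideanSpace ℝ (Fin n)) :=
  {z | ∀ y, dotObjective D x z ≤ dotObjective D x y}

/-- `q` is the push-forward of `pG` under a single-valued DOT map: a measurable map `x ↦ y_x`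
that picks, for almost every `x ∼ pG`, one minimizer of the DOT objective at `x`. -/
def IsDotMapLaw {n : ℕ} (D : EuclideanSpace ℝ (Fin n) → ℝ)
    (pG q : Measure (EuclideanSpace ℝ (Fin n))) : Prop :=
  ∃ Y : EuclideanSpace ℝ (Fin n) → EuclideanSpace ℝ (Fin n),
    Measurable Y ∧ (∀ᵐ x ∂pG, Y x ∈ dotArgmin D x) ∧ q = pG.map Y

/-- `q` is an admissible DOT distribution `p_ot`: the law of `y_x`, where `x ∼ pG` and, given
`x`, the point `y_x` is chosen, possibly at random, among the minimizers of the DOT objective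
at `x`. The choice is a Markov kernel `κ`, which is `δ_{y_x}` for a single-valued map. -/
def IsDotLaw {n : ℕ} (D : EuclideanSpace ℝ (Fin n) → ℝ)
    (pG q : Measure (EuclideanSpace ℝ (Fin n))) : Prop :=
  ∃ κ : Kernel (EuclideanSpace ℝ (Fin n)) (EuclideanSpace ℝ (Fin n)),
    IsMarkovKernel κ ∧ (∀ᵐ x ∂pG, ∀ᵐ y ∂(κ x), y ∈ dotArgmin D x) ∧ q = pG.bind κ

/-! Since `D` is 1-Lipschitz, `‖y - x‖ - D y ≥ -D x` with equality at `y = x`; the minimizers at `x`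
are exactly the points to which `D` climbs with slope one. Everything thus rests on complementary
slackness (`IsOptimalCritic.ae_sub_eq_norm`): `D y - D x = ‖x - y‖` for `π`-almost every pair. It
follows from duality: the support of an optimal plan is cyclically monotone, so it carries a
1-Lipschitz potential that saturates the cost, and an optimal critic does no worse.

Saturation passes to every point of the segment from `x` to `y`, and strictly inside it `D` is
pinched between two cones, which gives stationarity. As `pData ≠ pG`, mass really moves; a
measurable selection of saturated displacements `V`, scaled by `t ∈ [0, 1]`, gives a continuum of
minimizing maps whose laws are told apart by the mean of `D`. Disintegrating `π` exhibits `pData`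
itself. -/

/-! ### Cyclical monotonicity of the support of an optimal plan. -/

/-- A set of pairs is cyclically monotone for the Euclidean distance if no permutation of the
targets of finitely many of its pairs lowers the total distance. -/
def IsDistCyclicallyMonotone {n : ℕ}
    (S : Set (EuclideanSpace ℝ (Fin n) × EuclideanSpace ℝ (Fin n))) : Prop :=
  ∀ (N : ℕ) (p : Fin N → EuclideanSpace ℝ (Fin n) × EuclideanSpace ℝ (Fin n)),
    (∀ i, p i ∈ S) → ∀ σ : Equiv.Perm (Fin N),
      ∑ i, ‖(p i).1 - (p i).2‖ ≤ ∑ i, ‖(p i).1 - (p (σ i)).2‖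

theorem measure_map_finset_sum {α β ι : Type*} [MeasurableSpace α] [MeasurableSpace β]
    (s : Finset ι) (μ : ι → Measure α) {f : α → β} (hf : Measurable f) :
    (∑ i ∈ s, μ i).map f = ∑ i ∈ s, (μ i).map f := by
  ext t ht
  simp [Measure.map_apply hf ht, Measure.finsetSum_apply]

theorem IsTransportPlan.isProbabilityMeasure {n : ℕ}
    {π : Measure (EuclideanSpace ℝ (Fin n) × EuclideanSpace ℝ (Fin n))}
    {μ ν : Measure (EuclideanSpace ℝ (Fin n))} [IsProbabilityMeasure μ]
    (h : IsTransportPlan π μ ν) : IsProbabilityMeasure π := by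
  constructor
  have := congrArg (fun m : Measure _ => m Set.univ) h.1
  simpa [Measure.map_apply measurable_fst MeasurableSet.univ] using this

/-- Each summand is at most `π / card ι`, so the pieces can be cut out of `π` simultaneously even
when the sets `B i` overlap or coincide. -/
theorem sum_smul_cond_le {α ι : Type*} [MeasurableSpace α] [Fintype ι]
    (π : Measure α) [IsFiniteMeasure π] (B : ι → Set α) (hB : ∀ i, MeasurableSet (B i))
    (hpos : ∀ i, π (B i) ≠ 0) {c : ENNReal} (hc : ∀ i, c ≤ π (B i) / Fintype.card ι) :
    ∑ i, c • π[|B i] ≤ π := by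
  rw [Measure.le_iff]
  intro s hs
  rw [Measure.finsetSum_apply]
  calc ∑ i, (c • π[|B i]) s ≤ ∑ _i : ι, (Fintype.card ι : ENNReal)⁻¹ * π s := by
        refine Finset.sum_le_sum fun i _ => ?_
        rw [Measure.smul_apply, cond_apply (hB i), smul_eq_mul, ← mul_assoc]
        refine mul_le_mul' ?_ (measure_mono Set.inter_subset_right)
        calc c * (π (B i))⁻¹ ≤ π (B i) / Fintype.card ι * (π (B i))⁻¹ :=
              mul_le_mul' (hc i) le_rfl
          _ = (Fintype.card ι : ENNReal)⁻¹ := by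
              rw [ENNReal.div_eq_inv_mul, mul_assoc,
                ENNReal.mul_inv_cancel (hpos i) (measure_ne_top _ _), mul_one]
    _ ≤ π s := by
        rw [Finset.sum_const, Finset.card_univ, nsmul_eq_mul, ← mul_assoc]
        calc _ ≤ 1 * π s := mul_le_mul' (ENNReal.mul_inv_le_one _) le_rfl
          _ = π s := one_mul _

/-- If a permutation lowered the total distance, cutting equal small masses around the pairs and
recoupling them according to `σ` would give a cheaper plan. -/
theorem IsOptimalPlan.isDistCyclicallyMonotone_support {n : ℕ}
    {π : Measure (EuclideanSpace ℝ (Fin n) × EuclideanSpace ℝ (Fin n))}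
    {μ ν : Measure (EuclideanSpace ℝ (Fin n))} [IsProbabilityMeasure μ]
    (h : IsOptimalPlan π μ ν) (hfin : transportCost π ≠ ⊤) :
    IsDistCyclicallyMonotone π.support := by
  have : IsProbabilityMeasure π := h.1.isProbabilityMeasure
  intro N p hp σ
  by_contra! hlt
  have hN : 0 < N := by
    rcases Nat.eq_zero_or_pos N with rfl | h0
    · simp at hlt
    · exact h0
  have : Nonempty (Fin N) := ⟨⟨0, hN⟩⟩
  obtain ⟨ε, hε, hgap⟩ : ∃ ε : ℝ, 0 < ε ∧
      ∑ i, (‖(p i).1 - (p (σ i)).2‖ + 2 * ε) < ∑ i, (‖(p i).1 - (p i).2‖ - 2 * ε) := by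
    -- The errors add up to `4 * N * ε`, which this choice makes half of the gap.
    refine ⟨(∑ i, ‖(p i).1 - (p i).2‖ - ∑ i, ‖(p i).1 - (p (σ i)).2‖) / (8 * N), ?_, ?_⟩
    · exact div_pos (sub_pos.2 hlt) (by positivity)
    · have hN' : (N : ℝ) ≠ 0 := by positivity
      rw [Finset.sum_add_distrib, Finset.sum_sub_distrib]
      simp only [Finset.sum_const, Finset.card_univ, Fintype.card_fin, nsmul_eq_mul]
      field_simp
      linarith
  set B : Fin N → Set (EuclideanSpace ℝ (Fin n) × EuclideanSpace ℝ (Fin n)) :=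
    fun i => Metric.ball (p i).1 ε ×ˢ Metric.ball (p i).2 ε with hBdef
  have hBm : ∀ i, MeasurableSet (B i) := fun i => measurableSet_ball.prod measurableSet_ball
  have hBpos : ∀ i, π (B i) ≠ 0 := fun i =>
    (((Measure.mem_support_iff_forall _).1 (hp i)) _
      (prod_mem_nhds (Metric.ball_mem_nhds _ hε) (Metric.ball_mem_nhds _ hε))).ne'
  obtain ⟨i₀, hi₀⟩ := Finite.exists_min (fun i => π (B i))
  set c : ENNReal := π (B i₀) / Fintype.card (Fin N) with hcdef
  have hc0 : c ≠ 0 := (ENNReal.div_pos (hBpos _) (ENNReal.natCast_ne_top _)).ne'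
  have hctop : c ≠ ⊤ := ENNReal.div_ne_top (measure_ne_top _ _) (by simp; omega)
  have hP : ∀ i, IsProbabilityMeasure (π[|B i]) := fun i => cond_isProbabilityMeasure (hBpos i)
  have hPB : ∀ i, ∀ᵐ q ∂π[|B i], q ∈ B i := fun i => ae_cond_mem (hBm i)
  -- Sources near `p i` are coupled independently with targets near `p (σ i)`; summed over `i`, the
  -- marginals are unchanged.
  set Q : Fin N → Measure (EuclideanSpace ℝ (Fin n) × EuclideanSpace ℝ (Fin n)) :=
    fun i => ((π[|B i]).map Prod.fst).prod ((π[|B (σ i)]).map Prod.snd) with hQdef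
  have hP1 : ∀ i, IsProbabilityMeasure ((π[|B i]).map Prod.fst) := fun i =>
    Measure.isProbabilityMeasure_map measurable_fst.aemeasurable
  have hP2 : ∀ i, IsProbabilityMeasure ((π[|B i]).map Prod.snd) := fun i =>
    Measure.isProbabilityMeasure_map measurable_snd.aemeasurable
  have hQ : ∀ i, IsProbabilityMeasure (Q i) := fun i => by
    simp only [hQdef]; infer_instance
  have hle : ∑ i, c • π[|B i] ≤ π := sum_smul_cond_le π B hBm hBpos fun i =>
    ENNReal.div_le_div_right (hi₀ i) _
  have hτfin : IsFiniteMeasure (∑ i, c • π[|B i]) := isFiniteMeasure_of_le π hle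
  set ρ := π - ∑ i, c • π[|B i] with hρ
  have hdec : ρ + ∑ i, c • π[|B i] = π := Measure.sub_add_cancel_of_le hle
  have hplan : IsTransportPlan (ρ + ∑ i, c • Q i) μ ν := by
    constructor
    · rw [← h.1.1, ← hdec, Measure.map_add _ _ measurable_fst, Measure.map_add _ _ measurable_fst,
        measure_map_finset_sum _ _ measurable_fst, measure_map_finset_sum _ _ measurable_fst]
      congr 1
      refine Finset.sum_congr rfl fun i _ => ?_
      rw [Measure.map_smul, Measure.map_smul]
      congr 1
      exact Measure.fst_prod
    · rw [← h.1.2, ← hdec, Measure.map_add _ _ measurable_snd, Measure.map_add _ _ measurable_snd,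
        measure_map_finset_sum _ _ measurable_snd, measure_map_finset_sum _ _ measurable_snd]
      congr 1
      rw [← Equiv.sum_comp σ (fun i => (c • π[|B i]).map Prod.snd)]
      refine Finset.sum_congr rfl fun i _ => ?_
      rw [Measure.map_smul, Measure.map_smul]
      congr 1
      exact Measure.snd_prod
  have hcost : ∀ R : Fin N → Measure (EuclideanSpace ℝ (Fin n) × EuclideanSpace ℝ (Fin n)),
      transportCost (ρ + ∑ i, c • R i) = transportCost ρ + c * ∑ i, transportCost (R i) := by
    intro R
    simp only [transportCost]
    rw [lintegral_add_measure, lintegral_finsetSum_measure, Finset.mul_sum]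
    simp [lintegral_smul_measure]
  have hopt : transportCost π ≤ transportCost (ρ + ∑ i, c • Q i) := by
    rw [h.2]
    exact iInf₂_le (f := fun π' (_ : IsTransportPlan π' μ ν) => transportCost π') _ hplan
  -- Finiteness allows the cost of the untouched part `ρ` to be cancelled in `ENNReal`.
  have hρfin : transportCost ρ ≠ ⊤ := by
    intro htop
    apply hfin
    rw [← hdec, hcost, htop, top_add]
  have hsum : ∑ i, transportCost (π[|B i]) ≤ ∑ i, transportCost (Q i) := by
    rw [hcost] at hopt
    nth_rewrite 1 [← hdec] at hopt
    rw [hcost] at hopt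
    exact (ENNReal.mul_le_mul_iff_right hc0 hctop).1 ((ENNReal.add_le_add_iff_left hρfin).1 hopt)
  have hlow : ∀ i, ENNReal.ofReal (‖(p i).1 - (p i).2‖ - 2 * ε) ≤ transportCost (π[|B i]) := by
    intro i
    calc _ = ∫⁻ _q, ENNReal.ofReal (‖(p i).1 - (p i).2‖ - 2 * ε) ∂π[|B i] := by simp
      _ ≤ _ := by
        refine lintegral_mono_ae ?_
        filter_upwards [hPB i] with q hq
        refine ENNReal.ofReal_le_ofReal ?_
        have h1 : dist q.1 (p i).1 < ε := hq.1
        have h2 : dist q.2 (p i).2 < ε := hq.2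
        have := dist_triangle4 (p i).1 q.1 q.2 (p i).2
        rw [← dist_eq_norm, ← dist_eq_norm]
        rw [dist_comm] at h1
        linarith
  have hup : ∀ i, transportCost (Q i) ≤ ENNReal.ofReal (‖(p i).1 - (p (σ i)).2‖ + 2 * ε) := by
    intro i
    have ha1 : ∀ᵐ x ∂(π[|B i]).map Prod.fst, x ∈ Metric.ball (p i).1 ε := by
      refine (ae_map_iff measurable_fst.aemeasurable measurableSet_ball).2 ?_
      filter_upwards [hPB i] with q hq using hq.1
    have ha2 : ∀ᵐ y ∂(π[|B (σ i)]).map Prod.snd, y ∈ Metric.ball (p (σ i)).2 ε := by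
      refine (ae_map_iff measurable_snd.aemeasurable measurableSet_ball).2 ?_
      filter_upwards [hPB (σ i)] with q hq using hq.2
    have hb1 : ∀ᵐ q ∂Q i, q.1 ∈ Metric.ball (p i).1 ε :=
      Measure.quasiMeasurePreserving_fst.ae ha1
    have hb2 : ∀ᵐ q ∂Q i, q.2 ∈ Metric.ball (p (σ i)).2 ε :=
      Measure.quasiMeasurePreserving_snd.ae ha2
    calc transportCost (Q i)
        ≤ ∫⁻ _q, ENNReal.ofReal (‖(p i).1 - (p (σ i)).2‖ + 2 * ε) ∂Q i := by
          refine lintegral_mono_ae ?_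
          filter_upwards [hb1, hb2] with q h1 h2
          refine ENNReal.ofReal_le_ofReal ?_
          rw [Metric.mem_ball] at h1 h2
          have := dist_triangle4 q.1 (p i).1 (p (σ i)).2 q.2
          rw [← dist_eq_norm, ← dist_eq_norm]
          rw [dist_comm] at h2
          linarith
      _ = _ := by simp
  have hfinal : ENNReal.ofReal (∑ i, (‖(p i).1 - (p i).2‖ - 2 * ε)) ≤
      ENNReal.ofReal (∑ i, (‖(p i).1 - (p (σ i)).2‖ + 2 * ε)) := by
    rw [ENNReal.ofReal_sum_of_nonneg (f := fun i => ‖(p i).1 - (p (σ i)).2‖ + 2 * ε)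
      fun i _ => by positivity]
    refine le_trans ?_ (hsum.trans (Finset.sum_le_sum fun i _ => hup i))
    refine le_trans ?_ (Finset.sum_le_sum fun i _ => hlow i)
    -- The terms may be negative and are then truncated by `ENNReal.ofReal`; subadditivity still
    -- gives the needed direction.
    exact Finset.le_sum_of_subadditive ENNReal.ofReal ENNReal.ofReal_zero.le
      (fun _ _ => ENNReal.ofReal_add_le) _ _
  rw [ENNReal.ofReal_le_ofReal_iff (Finset.sum_nonneg fun i _ => by positivity)] at hfinal
  exact absurd hgap (not_lt.2 hfinal)

/-! ### Kantorovich potential of a cyclically monotone set. -/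

/-- The cost of travelling from the origin to `z` along the pairs `s 0, …, s N`, where each pair
is traversed backwards, from target to source, and its length is earned instead of paid. -/
noncomputable def chainCost {n : ℕ}
    (s : ℕ → EuclideanSpace ℝ (Fin n) × EuclideanSpace ℝ (Fin n)) (N : ℕ)
    (z : EuclideanSpace ℝ (Fin n)) : ℝ :=
  ‖(s 0).2‖ + ∑ i ∈ Finset.range N, ‖(s i).1 - (s (i + 1)).2‖
    - ∑ i ∈ Finset.range (N + 1), ‖(s i).1 - (s i).2‖ + ‖(s N).1 - z‖

/-- Closing the chain into a cycle through `z` and the origin costs at most `‖z‖` more, by the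
triangle inequality. The bound keeps the infimum that defines the potential finite. -/
theorem IsDistCyclicallyMonotone.neg_norm_le_chainCost {n : ℕ}
    {S : Set (EuclideanSpace ℝ (Fin n) × EuclideanSpace ℝ (Fin n))}
    (hS : IsDistCyclicallyMonotone S)
    {s : ℕ → EuclideanSpace ℝ (Fin n) × EuclideanSpace ℝ (Fin n)} (hs : ∀ i, s i ∈ S) (N : ℕ)
    (z : EuclideanSpace ℝ (Fin n)) : -‖z‖ ≤ chainCost s N z := by
  have h := hS (N + 1) (fun i => s i) (fun i => hs i) (finRotate (N + 1))
  rw [Fin.sum_univ_castSucc (n := N) (fun i => ‖(s i).1 - (s (finRotate (N + 1) i)).2‖)] at h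
  rw [Fin.sum_univ_eq_sum_range (fun i => ‖(s i).1 - (s i).2‖)] at h
  have h2 : ∑ i : Fin N, ‖(s i.castSucc).1 - (s (finRotate (N + 1) i.castSucc)).2‖ =
      ∑ i ∈ Finset.range N, ‖(s i).1 - (s (i + 1)).2‖ := by
    rw [← Fin.sum_univ_eq_sum_range (fun i => ‖(s i).1 - (s (i + 1)).2‖)]
    simp
  rw [h2, finRotate_last] at h
  simp only [Fin.val_last, Fin.val_zero] at h
  have h3 : ‖(s N).1 - (s 0).2‖ ≤ ‖(s N).1 - z‖ + ‖z‖ + ‖(s 0).2‖ := by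
    have e : (s N).1 - (s 0).2 = ((s N).1 - z) + z - (s 0).2 := by abel
    rw [e]
    exact (norm_sub_le _ _).trans (add_le_add_left (norm_add_le _ _) _)
  simp only [chainCost]
  linarith

/-- A cyclically monotone set has a Kantorovich potential: a 1-Lipschitz function that grows with
slope one along each of its pairs. -/
theorem IsDistCyclicallyMonotone.exists_potential {n : ℕ}
    {S : Set (EuclideanSpace ℝ (Fin n) × EuclideanSpace ℝ (Fin n))}
    (hS : IsDistCyclicallyMonotone S) (hne : S.Nonempty) :
    ∃ f : EuclideanSpace ℝ (Fin n) → ℝ, LipschitzWith 1 f ∧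
      ∀ p ∈ S, f p.2 - f p.1 = ‖p.1 - p.2‖ := by
  have : Nonempty S := hne.to_subtype
  set f : EuclideanSpace ℝ (Fin n) → ℝ :=
    fun z => ⨅ c : (ℕ → S) × ℕ, chainCost (fun i => (c.1 i).1) c.2 z with hf
  have hbdd : ∀ z, BddBelow
      (Set.range fun c : (ℕ → S) × ℕ => chainCost (fun i => (c.1 i).1) c.2 z) := by
    rintro z
    refine ⟨-‖z‖, ?_⟩
    rintro _ ⟨c, rfl⟩
    exact hS.neg_norm_le_chainCost (fun i => (c.1 i).2) _ _
  have hLip : ∀ x y, f x ≤ f y + dist x y := by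
    intro x y
    rw [← sub_le_iff_le_add]
    refine le_ciInf fun c => ?_
    rw [sub_le_iff_le_add]
    refine (ciInf_le (hbdd x) c).trans ?_
    have := dist_triangle (c.1 c.2).1.1 y x
    rw [dist_eq_norm, dist_eq_norm, dist_comm] at this
    simp only [chainCost]
    linarith
  refine ⟨f, LipschitzWith.of_le_add hLip, ?_⟩
  rintro ⟨x, y⟩ hp
  refine le_antisymm ?_ ?_
  · have := hLip y x
    rw [dist_comm, dist_eq_norm] at this
    linarith
  · rw [le_sub_iff_add_le]
    refine le_ciInf fun c => ?_
    obtain ⟨s, N⟩ := c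
    rw [← le_sub_iff_add_le']
    refine (ciInf_le (hbdd x) (fun i => if i ≤ N then s i else ⟨(x, y), hp⟩, N + 1)).trans ?_
    have e1 : ∑ i ∈ Finset.range N, ‖((if i ≤ N then s i else ⟨(x, y), hp⟩ : S).1).1 -
        ((if i + 1 ≤ N then s (i + 1) else ⟨(x, y), hp⟩ : S).1).2‖ =
        ∑ i ∈ Finset.range N, ‖(s i).1.1 - (s (i + 1)).1.2‖ := by
      refine Finset.sum_congr rfl fun i hi => ?_
      have := Finset.mem_range.1 hi
      rw [if_pos (by omega), if_pos (by omega)]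
    have e2 : ∑ i ∈ Finset.range (N + 1), ‖((if i ≤ N then s i else ⟨(x, y), hp⟩ : S).1).1 -
        ((if i ≤ N then s i else ⟨(x, y), hp⟩ : S).1).2‖ =
        ∑ i ∈ Finset.range (N + 1), ‖(s i).1.1 - (s i).1.2‖ := by
      refine Finset.sum_congr rfl fun i hi => ?_
      have := Finset.mem_range.1 hi
      rw [if_pos (by omega)]
    simp only [chainCost]
    rw [Finset.sum_range_succ _ N, Finset.sum_range_succ _ (N + 1), e1, e2]
    simp
    linarith

/-! ### Duality and complementary slackness. -/

theorem LipschitzWith.integrable_of_integrable_norm {n : ℕ}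
    {μ : Measure (EuclideanSpace ℝ (Fin n))} [IsFiniteMeasure μ]
    {f : EuclideanSpace ℝ (Fin n) → ℝ} (hf : LipschitzWith 1 f)
    (hμ : Integrable (fun x => ‖x‖) μ) : Integrable f μ := by
  refine (hμ.add (integrable_const ‖f 0‖)).mono' hf.continuous.aestronglyMeasurable
    (.of_forall fun x => ?_)
  have h1 := hf.dist_le_mul x 0
  simp only [dist_eq_norm, NNReal.coe_one, one_mul, sub_zero] at h1
  have h2 := norm_add_le (f x - f 0) (f 0)
  rw [sub_add_cancel] at h2
  simp only [Pi.add_apply]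
  linarith

theorem integral_sub_integral_of_isTransportPlan {n : ℕ}
    {μ ν : Measure (EuclideanSpace ℝ (Fin n))}
    [IsProbabilityMeasure μ] [IsProbabilityMeasure ν]
    (hμ : Integrable (fun x => ‖x‖) μ) (hν : Integrable (fun x => ‖x‖) ν)
    {π : Measure (EuclideanSpace ℝ (Fin n) × EuclideanSpace ℝ (Fin n))}
    (hπ : IsTransportPlan π μ ν)
    {f : EuclideanSpace ℝ (Fin n) → ℝ} (hf : LipschitzWith 1 f) :
    Integrable (fun p => f p.2 - f p.1) π ∧
      ∫ x, f x ∂ν - ∫ x, f x ∂μ = ∫ p, (f p.2 - f p.1) ∂π := by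
  have h1 : Integrable (fun p : _ × _ => f p.1) π := by
    have := hf.integrable_of_integrable_norm hμ
    rw [← hπ.1] at this
    exact this.comp_measurable measurable_fst
  have h2 : Integrable (fun p : _ × _ => f p.2) π := by
    have := hf.integrable_of_integrable_norm hν
    rw [← hπ.2] at this
    exact this.comp_measurable measurable_snd
  refine ⟨h2.sub h1, ?_⟩
  rw [integral_sub h2 h1, ← hπ.1, ← hπ.2,
    integral_map measurable_fst.aemeasurable hf.continuous.aestronglyMeasurable,
    integral_map measurable_snd.aemeasurable hf.continuous.aestronglyMeasurable]

theorem IsTransportPlan.integrable_norm_sub {n : ℕ}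
    {μ ν : Measure (EuclideanSpace ℝ (Fin n))}
    (hμ : Integrable (fun x => ‖x‖) μ) (hν : Integrable (fun x => ‖x‖) ν)
    {π : Measure (EuclideanSpace ℝ (Fin n) × EuclideanSpace ℝ (Fin n))}
    (hπ : IsTransportPlan π μ ν) : Integrable (fun p => ‖p.1 - p.2‖) π := by
  rw [← hπ.1] at hμ
  rw [← hπ.2] at hν
  refine ((hμ.comp_measurable measurable_fst).add (hν.comp_measurable measurable_snd)).mono'
    (by fun_prop) (.of_forall fun p => ?_)
  simpa using norm_sub_le p.1 p.2

/-- Kantorovich-Rubinstein duality in the form of complementary slackness: an optimal critic grows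
with slope one along almost every pair of an optimal plan. -/
theorem IsOptimalCritic.ae_sub_eq_norm {n : ℕ}
    {pG pData : Measure (EuclideanSpace ℝ (Fin n))}
    [IsProbabilityMeasure pG] [IsProbabilityMeasure pData]
    (hG : Integrable (fun x => ‖x‖) pG) (hData : Integrable (fun x => ‖x‖) pData)
    {π : Measure (EuclideanSpace ℝ (Fin n) × EuclideanSpace ℝ (Fin n))}
    (hπ : IsOptimalPlan π pG pData)
    {D : EuclideanSpace ℝ (Fin n) → ℝ} (hD : IsOptimalCritic D pG pData) :
    ∀ᵐ p ∂π, D p.2 - D p.1 = ‖p.1 - p.2‖ := by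
  have : IsProbabilityMeasure π := hπ.1.isProbabilityMeasure
  have hcost := hπ.1.integrable_norm_sub hG hData
  have hfin : transportCost π ≠ ⊤ := by
    rw [transportCost, ← ofReal_integral_eq_lintegral_ofReal hcost (.of_forall fun _ => norm_nonneg _)]
    exact ENNReal.ofReal_ne_top
  obtain ⟨f, hf, hfS⟩ := (hπ.isDistCyclicallyMonotone_support hfin).exists_potential
    (Measure.nonempty_support (IsProbabilityMeasure.ne_zero π))
  have hfae : ∀ᵐ p ∂π, f p.2 - f p.1 = ‖p.1 - p.2‖ := by
    filter_upwards [Measure.support_mem_ae (μ := π)] with p hp using hfS p hp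
  obtain ⟨hDi, hDe⟩ := integral_sub_integral_of_isTransportPlan hG hData hπ.1 hD.1
  have hfe := (integral_sub_integral_of_isTransportPlan hG hData hπ.1 hf).2
  have hopt := hD.2 f hf
  rw [hDe, hfe, integral_congr_ae hfae] at hopt
  have hle : (fun p : EuclideanSpace ℝ (Fin n) × EuclideanSpace ℝ (Fin n) => D p.2 - D p.1) ≤ᵐ[π]
      fun p => ‖p.1 - p.2‖ := .of_forall fun p => by
    have := hD.1.dist_le_mul p.2 p.1
    rw [dist_comm p.2, dist_eq_norm p.1, Real.dist_eq] at this
    simpa using (le_abs_self _).trans this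
  -- A pointwise inequality whose two sides have equal integrals is an equality almost everywhere.
  exact (integral_eq_iff_of_ae_le hDi hcost hle).1 (le_antisymm (integral_mono_ae hDi hcost hle) hopt)

/-! ### Minimizers and stationarity along transport rays. -/

theorem LipschitzWith.sub_le_norm_sub {n : ℕ} {D : EuclideanSpace ℝ (Fin n) → ℝ}
    (hD : LipschitzWith 1 D) (x y : EuclideanSpace ℝ (Fin n)) : D y - D x ≤ ‖y - x‖ := by
  have := hD.dist_le_mul y x
  rw [dist_eq_norm y, Real.dist_eq] at this
  simpa using (le_abs_self _).trans this

theorem mem_dotArgmin_iff {n : ℕ} {D : EuclideanSpace ℝ (Fin n) → ℝ}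
    (hD : LipschitzWith 1 D) {x z : EuclideanSpace ℝ (Fin n)} :
    z ∈ dotArgmin D x ↔ D z - D x = ‖z - x‖ := by
  simp only [dotArgmin, dotObjective, Set.mem_ofPred_eq]
  constructor
  · intro h
    have := h x
    rw [sub_self, norm_zero] at this
    linarith [hD.sub_le_norm_sub x z]
  · intro h y
    linarith [hD.sub_le_norm_sub x y]

/-- The Lipschitz bounds on the two halves add up to an equality, so each is sharp. -/
theorem sub_eq_norm_of_mem_segment {n : ℕ} {D : EuclideanSpace ℝ (Fin n) → ℝ}
    (hD : LipschitzWith 1 D) {x y z : EuclideanSpace ℝ (Fin n)}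
    (hxy : D y - D x = ‖y - x‖) (hz : z ∈ segment ℝ x y) :
    D z - D x = ‖z - x‖ ∧ D y - D z = ‖y - z‖ := by
  have h := dist_add_dist_of_mem_segment hz
  rw [dist_comm x z, dist_comm z y, dist_comm x y, dist_eq_norm, dist_eq_norm, dist_eq_norm] at h
  have h1 := hD.sub_le_norm_sub x z
  have h2 := hD.sub_le_norm_sub z y
  constructor <;> linarith

theorem hasGradientAt_dotObjective_of_differentiableAt {n : ℕ}
    {D : EuclideanSpace ℝ (Fin n) → ℝ} {x z : EuclideanSpace ℝ (Fin n)}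
    (hz : z ∈ dotArgmin D x) (hzx : z ≠ x) (hD : DifferentiableAt ℝ D z) :
    HasGradientAt (dotObjective D x) 0 z := by
  have hd : DifferentiableAt ℝ (dotObjective D x) z :=
    ((differentiableAt_id.sub_const x).norm ℝ (sub_ne_zero.2 hzx)).sub hD
  have hmin : IsLocalMin (dotObjective D x) z := .of_forall hz
  rw [hasGradientAt_iff_hasFDerivAt, map_zero, ← hmin.fderiv_eq_zero]
  exact hd.hasFDerivAt

/-- In the interior of a transport ray, the critic is squeezed between two cones that touch, so
that its gradient exists there. -/
theorem hasGradientAt_dotObjective_of_ne {n : ℕ}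
    {D : EuclideanSpace ℝ (Fin n) → ℝ} (hD : LipschitzWith 1 D)
    {x y z : EuclideanSpace ℝ (Fin n)} (hxz : D z - D x = ‖z - x‖) (hzy : D y - D z = ‖y - z‖)
    (hzx : z ≠ x) (hne : z ≠ y) :
    HasGradientAt (dotObjective D x) 0 z := by
  set h : EuclideanSpace ℝ (Fin n) → ℝ := fun w => ‖w - x‖ + ‖y - w‖ with hh
  have hd : DifferentiableAt ℝ h z :=
    ((differentiableAt_id.sub_const x).norm ℝ (sub_ne_zero.2 hzx)).add
      ((differentiableAt_id.const_sub y).norm ℝ (sub_ne_zero.2 hne.symm))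
  have hmin : IsLocalMin h z := .of_forall fun w => by
    have h1 := hD.sub_le_norm_sub x w
    have h2 := hD.sub_le_norm_sub w y
    simp only [hh]
    linarith
  have hder : HasFDerivAt h (0 : EuclideanSpace ℝ (Fin n) →L[ℝ] ℝ) z := by
    rw [← hmin.fderiv_eq_zero]
    exact hd.hasFDerivAt
  rw [hasGradientAt_iff_hasFDerivAt, map_zero]
  rw [hasFDerivAt_iff_isLittleO] at hder ⊢
  -- The increment of the objective from `z` lies between `0` and that of `h`, which is `o(‖w -
  -- z‖)`.
  refine (Asymptotics.IsBigO.of_bound 1 (.of_forall fun w => ?_)).trans_isLittleO hder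
  have h1 := hD.sub_le_norm_sub x w
  have h2 := hD.sub_le_norm_sub w y
  simp only [dotObjective, zero_apply, sub_zero, one_mul, Real.norm_eq_abs, hh]
  rw [abs_of_nonneg (by linarith)]
  refine le_trans ?_ (le_abs_self _)
  linarith

/-! ### Measurable selection. -/

/-- Passing to the minimizers of a continuous function keeps a compact-valued multifunction
measurable. -/
theorem measurableSet_inter_argmin_nonempty {α E : Type*} [MeasurableSpace α]
    [TopologicalSpace E] [T2Space E] {K : α → Set E} (hK : ∀ a, IsCompact (K a))
    (hmeas : ∀ F, IsClosed F → MeasurableSet {a | (K a ∩ F).Nonempty})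
    {g : E → ℝ} (hg : Continuous g) {F : Set E} (hF : IsClosed F) :
    MeasurableSet {a | ({v ∈ K a | ∀ w ∈ K a, g v ≤ g w} ∩ F).Nonempty} := by
  -- `F` contains a minimizer iff `K a ∩ F` is nonempty and meets every rational sublevel set that
  -- `K a` meets; only countably many conditions arise.
  have key : {a | ({v ∈ K a | ∀ w ∈ K a, g v ≤ g w} ∩ F).Nonempty} =
      {a | (K a ∩ F).Nonempty} ∩ ⋂ q : ℚ, ({a | (K a ∩ {v | g v ≤ q}).Nonempty}ᶜ ∪
        {a | (K a ∩ (F ∩ {v | g v ≤ q})).Nonempty}) := by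
    ext a
    simp only [Set.mem_inter_iff, Set.mem_iInter, Set.mem_union, Set.mem_compl_iff,
      Set.mem_ofPred_eq]
    constructor
    · rintro ⟨v, ⟨hv, hmin⟩, hvF⟩
      refine ⟨⟨v, hv, hvF⟩, fun q => ?_⟩
      rw [or_iff_not_imp_left, not_not]
      rintro ⟨w, hw, hwq⟩
      exact ⟨v, hv, hvF, (hmin w hw).trans hwq⟩
    · rintro ⟨hne, hq⟩
      obtain ⟨v, ⟨hv, hvF⟩, hvmin⟩ := ((hK a).inter_right hF).exists_isMinOn hne hg.continuousOn
      refine ⟨v, ⟨hv, fun w hw => ?_⟩, hvF⟩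
      by_contra! hlt
      obtain ⟨q, hq1, hq2⟩ := exists_rat_btwn hlt
      rcases hq q with h | ⟨u, hu, huF, huq⟩
      · exact h ⟨w, hw, hq1.le⟩
      · have : g v ≤ g u := hvmin ⟨hu, huF⟩
        have huq' : g u ≤ q := huq
        linarith
  rw [key]
  have hcl : ∀ q : ℚ, IsClosed {v | g v ≤ (q : ℝ)} := fun q => isClosed_le hg continuous_const
  exact (hmeas F hF).inter (.iInter fun q =>
    (hmeas _ (hcl q)).compl.union (hmeas _ (hF.inter (hcl q))))

/-- Lexicographic minimization: minimizing one coordinate after another freezes each in turn, so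
that at most one point remains once all are used. -/
theorem exists_submultifunction_eq_on_coordinates {α : Type*} [MeasurableSpace α] {n : ℕ}
    {K : α → Set (EuclideanSpace ℝ (Fin n))} (hK : ∀ a, IsCompact (K a))
    (hmeas : ∀ F, IsClosed F → MeasurableSet {a | (K a ∩ F).Nonempty}) (s : Finset (Fin n)) :
    ∃ K' : α → Set (EuclideanSpace ℝ (Fin n)), (∀ a, K' a ⊆ K a) ∧ (∀ a, IsCompact (K' a)) ∧
      (∀ F, IsClosed F → MeasurableSet {a | (K' a ∩ F).Nonempty}) ∧
      (∀ a, (K a).Nonempty → (K' a).Nonempty) ∧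
      ∀ a, ∀ v ∈ K' a, ∀ w ∈ K' a, ∀ i ∈ s, v i = w i := by
  induction s using Finset.induction_on with
  | empty => exact ⟨K, fun _ => le_rfl, hK, hmeas, fun _ h => h, by simp⟩
  | insert j s _ ih =>
    obtain ⟨K', hsub, hcomp, hm, hne, heq⟩ := ih
    have hg : Continuous fun v : EuclideanSpace ℝ (Fin n) => v j := by fun_prop
    refine ⟨fun a => {v ∈ K' a | ∀ w ∈ K' a, v j ≤ w j}, fun a v hv => hsub a hv.1, fun a => ?_,
      fun F hF => measurableSet_inter_argmin_nonempty hcomp hm hg hF, fun a ha => ?_, ?_⟩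
    · have : {v ∈ K' a | ∀ w ∈ K' a, v j ≤ w j} = K' a ∩ ⋂ w ∈ K' a, {v | v j ≤ w j} := by
        ext v; simp
      beta_reduce
      rw [this]
      exact (hcomp a).inter_right
        (isClosed_biInter fun w _ => isClosed_le hg continuous_const)
    · obtain ⟨v, hv, hmin⟩ := (hcomp a).exists_isMinOn (hne a ha) hg.continuousOn
      exact ⟨v, hv, fun w hw => hmin hw⟩
    · intro a v hv w hw i hi
      rcases Finset.mem_insert.1 hi with rfl | hi
      · exact le_antisymm (hv.2 w hw.1) (hw.2 v hv.1)
      · exact heq a v hv.1 w hw.1 i hi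

/-- A measurable selection theorem for compact-valued multifunctions into a Euclidean space. -/
theorem exists_measurable_selection {α : Type*} [MeasurableSpace α] {n : ℕ}
    {K : α → Set (EuclideanSpace ℝ (Fin n))} (hK : ∀ a, IsCompact (K a))
    (hmeas : ∀ F, IsClosed F → MeasurableSet {a | (K a ∩ F).Nonempty}) :
    ∃ T : α → EuclideanSpace ℝ (Fin n), Measurable T ∧ (∀ a, (K a).Nonempty → T a ∈ K a) ∧
      ∀ a, ¬ (K a).Nonempty → T a = 0 := by
  classical
  obtain ⟨K', hsub, -, hm, hne, heq⟩ :=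
    exists_submultifunction_eq_on_coordinates hK hmeas Finset.univ
  refine ⟨fun a => if h : (K' a).Nonempty then h.some else 0, ?_, fun a ha => ?_, fun a ha => ?_⟩
  · refine measurable_of_isClosed fun F hF => ?_
    have : (fun a => if h : (K' a).Nonempty then h.some else 0) ⁻¹' F =
        {a | (K' a ∩ F).Nonempty} ∪
          ({a | (K' a ∩ Set.univ).Nonempty}ᶜ ∩ {_a | (0 : EuclideanSpace ℝ (Fin n)) ∈ F}) := by
      ext a
      simp only [Set.mem_preimage, Set.mem_union, Set.mem_inter_iff, Set.mem_compl_iff,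
        Set.mem_ofPred_eq, Set.inter_univ]
      by_cases h : (K' a).Nonempty
      · simp only [h, dif_pos, not_true_eq_false, false_and, or_false]
        constructor
        · exact fun hF => ⟨_, h.some_mem, hF⟩
        · rintro ⟨v, hv, hvF⟩
          have : h.some = v := by
            ext i
            exact heq a _ h.some_mem _ hv i (Finset.mem_univ i)
          rwa [this]
      · have h' : ¬ (K' a ∩ F).Nonempty := fun h2 => h h2.left
        simp [h, h']
    rw [this]
    exact (hm F hF).union ((hm _ isClosed_univ).compl.inter (.const _))
  · have := hne a ha
    simp only [this, dif_pos]
    exact hsub a this.some_mem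
  · have : ¬ (K' a).Nonempty := fun h => ha (h.mono (hsub a))
    simp [this]

/-! ### Saturated displacements and infinitely many laws. -/

/-- The displacements of length between `1 / (k + 1)` and `k + 1` that lead from `x` to a minimizer
of the DOT objective at `x`. -/
def dotDisplacements {n : ℕ} (D : EuclideanSpace ℝ (Fin n) → ℝ) (k : ℕ)
    (x : EuclideanSpace ℝ (Fin n)) : Set (EuclideanSpace ℝ (Fin n)) :=
  {v | ‖v‖ ≤ k + 1 ∧ 1 / ((k : ℝ) + 1) ≤ ‖v‖ ∧ D (x + v) - D x = ‖v‖}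

theorem isCompact_dotDisplacements {n : ℕ} {D : EuclideanSpace ℝ (Fin n) → ℝ}
    (hD : Continuous D) (k : ℕ) (x : EuclideanSpace ℝ (Fin n)) :
    IsCompact (dotDisplacements D k x) := by
  refine (isCompact_closedBall (0 : EuclideanSpace ℝ (Fin n)) (k + 1)).of_isClosed_subset ?_
    fun v hv => by simpa using hv.1
  have h1 : IsClosed {v : EuclideanSpace ℝ (Fin n) | ‖v‖ ≤ k + 1} :=
    isClosed_le (by fun_prop) (by fun_prop)
  have h2 : IsClosed {v : EuclideanSpace ℝ (Fin n) | 1 / ((k : ℝ) + 1) ≤ ‖v‖} :=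
    isClosed_le (by fun_prop) (by fun_prop)
  have h3 : IsClosed {v : EuclideanSpace ℝ (Fin n) | D (x + v) - D x = ‖v‖} :=
    isClosed_eq (by fun_prop) (by fun_prop)
  exact h1.inter (h2.inter h3)

/-- The set is the projection of a closed set along the compact ball of displacements; this supplies
the measurability needed for selection. -/
theorem isClosed_dotDisplacements_inter_nonempty {n : ℕ} {D : EuclideanSpace ℝ (Fin n) → ℝ}
    (hD : Continuous D) (k : ℕ) {F : Set (EuclideanSpace ℝ (Fin n))} (hF : IsClosed F) :
    IsClosed {x | (dotDisplacements D k x ∩ F).Nonempty} := by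
  set C := Metric.closedBall (0 : EuclideanSpace ℝ (Fin n)) (k + 1)
  have : CompactSpace C := isCompact_iff_compactSpace.1 (isCompact_closedBall _ _)
  have h1 : IsClosed {p : EuclideanSpace ℝ (Fin n) × C |
      1 / ((k : ℝ) + 1) ≤ ‖(p.2 : EuclideanSpace ℝ (Fin n))‖} :=
    isClosed_le (by fun_prop) (by fun_prop)
  have h2 : IsClosed {p : EuclideanSpace ℝ (Fin n) × C |
      D (p.1 + p.2) - D p.1 = ‖(p.2 : EuclideanSpace ℝ (Fin n))‖} :=
    isClosed_eq (by fun_prop) (by fun_prop)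
  have h3 : IsClosed {p : EuclideanSpace ℝ (Fin n) × C |
      (p.2 : EuclideanSpace ℝ (Fin n)) ∈ F} := hF.preimage (by fun_prop)
  convert isClosedMap_fst_of_compactSpace _ ((h1.inter h2).inter h3) using 1
  ext x
  simp only [dotDisplacements, Set.mem_image, Set.mem_ofPred_eq, Prod.exists, Set.Nonempty,
    Set.mem_inter_iff]
  constructor
  · rintro ⟨v, ⟨h1, h2, h3⟩, h4⟩
    exact ⟨x, ⟨v, by simpa [C] using h1⟩, ⟨⟨h2, h3⟩, h4⟩, rfl⟩
  · rintro ⟨x', ⟨v, hv⟩, ⟨⟨h2, h3⟩, h4⟩, rfl⟩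
    exact ⟨v, ⟨by simpa [C] using hv, h2, h3⟩, h4⟩

theorem IsTransportPlan.eq_of_ae_eq {n : ℕ}
    {π : Measure (EuclideanSpace ℝ (Fin n) × EuclideanSpace ℝ (Fin n))}
    {μ ν : Measure (EuclideanSpace ℝ (Fin n))} (h : IsTransportPlan π μ ν)
    (hae : ∀ᵐ p ∂π, p.1 = p.2) : μ = ν := by
  rw [← h.1, ← h.2]
  exact Measure.map_congr hae

/-- Otherwise `π` would be concentrated on the diagonal and its marginals would agree, since any
nonzero displacement fits the length bounds for large `k`. -/
theorem exists_measure_dotDisplacements_nonempty_ne_zero {n : ℕ}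
    {pG pData : Measure (EuclideanSpace ℝ (Fin n))}
    {π : Measure (EuclideanSpace ℝ (Fin n) × EuclideanSpace ℝ (Fin n))}
    (hπ : IsTransportPlan π pG pData) {D : EuclideanSpace ℝ (Fin n) → ℝ}
    (hae : ∀ᵐ p ∂π, D p.2 - D p.1 = ‖p.1 - p.2‖) (hne : pData ≠ pG) :
    ∃ k : ℕ, pG {x | (dotDisplacements D k x).Nonempty} ≠ 0 := by
  by_contra! h
  have h0 : ∀ᵐ x ∂pG, ∀ k : ℕ, ¬ (dotDisplacements D k x).Nonempty := by
    rw [ae_all_iff]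
    intro k
    rw [ae_iff]
    simpa using h k
  rw [← hπ.1] at h0
  refine hne (hπ.eq_of_ae_eq ?_).symm
  filter_upwards [hae, ae_of_ae_map measurable_fst.aemeasurable h0] with p hp hp0
  by_contra hxy
  have hpos : 0 < ‖p.2 - p.1‖ := norm_pos_iff.2 (sub_ne_zero.2 (Ne.symm hxy))
  obtain ⟨k₁, hk₁⟩ := exists_nat_one_div_lt hpos
  obtain ⟨k₂, hk₂⟩ := exists_nat_gt ‖p.2 - p.1‖
  refine hp0 (max k₁ k₂) ⟨p.2 - p.1, ?_, ?_, ?_⟩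
  · have : (k₂ : ℝ) ≤ (max k₁ k₂ : ℕ) := by exact_mod_cast le_max_right _ _
    linarith
  · refine le_trans (one_div_le_one_div_of_le (by positivity) ?_) hk₁.le
    have : (k₁ : ℝ) ≤ (max k₁ k₂ : ℕ) := by exact_mod_cast le_max_left _ _
    linarith
  · rw [add_sub_cancel, hp, norm_sub_rev]

/-- Moving the points of positive transport distance only a fraction of their way yields pairwise
different laws, because the mean value of the critic grows with the fraction. -/
theorem infinite_setOf_isDotMapLaw {n : ℕ}
    {pG : Measure (EuclideanSpace ℝ (Fin n))} [IsProbabilityMeasure pG]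
    (hG : Integrable (fun x => ‖x‖) pG) {D : EuclideanSpace ℝ (Fin n) → ℝ}
    (hD : LipschitzWith 1 D) {k : ℕ} (hk : pG {x | (dotDisplacements D k x).Nonempty} ≠ 0) :
    {q | IsDotMapLaw D pG q}.Infinite := by
  obtain ⟨V, hVm, hV, hV0⟩ := exists_measurable_selection
    (isCompact_dotDisplacements hD.continuous k)
    (fun F hF => (isClosed_dotDisplacements_inter_nonempty hD.continuous k hF).measurableSet)
  -- Where nothing can be selected, the default `V x = 0` leaves `x` in place, and `x` is itself a
  -- minimizer.
  have hVD : ∀ x, D (x + V x) - D x = ‖V x‖ := by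
    intro x
    by_cases h : (dotDisplacements D k x).Nonempty
    · exact (hV x h).2.2
    · simp [hV0 x h]
  have hVb : ∀ x, ‖V x‖ ≤ k + 1 := by
    intro x
    by_cases h : (dotDisplacements D k x).Nonempty
    · exact (hV x h).1
    · rw [hV0 x h, norm_zero]; positivity
  have hVint : Integrable (fun x => ‖V x‖) pG :=
    (integrable_const ((k : ℝ) + 1)).mono' hVm.norm.aestronglyMeasurable
      (.of_forall fun x => by simpa using hVb x)
  have hpos : 0 < ∫ x, ‖V x‖ ∂pG := by
    rw [integral_pos_iff_support_of_nonneg (fun _ => norm_nonneg _) hVint]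
    refine (pos_iff_ne_zero.2 hk).trans_le (measure_mono fun x hx => ?_)
    have := (hV x hx).2.1
    exact ((by positivity : (0 : ℝ) < 1 / ((k : ℝ) + 1)).trans_le this).ne'
  have hDt : ∀ t ∈ Set.Icc (0 : ℝ) 1, ∀ x, D (x + t • V x) - D x = t * ‖V x‖ := by
    intro t ht x
    have hseg : x + t • V x ∈ segment ℝ x (x + V x) := by
      rw [segment_eq_image']
      exact ⟨t, ht, by simp⟩
    have := (sub_eq_norm_of_mem_segment hD (by simpa using hVD x) hseg).1
    rw [this, add_sub_cancel_left, norm_smul, Real.norm_of_nonneg ht.1]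
  have hYm : ∀ t : ℝ, Measurable fun x => x + t • V x := fun t => by fun_prop
  refine Set.infinite_of_injOn_mapsTo (f := fun t : ℝ => pG.map fun x => x + t • V x)
    (s := Set.Icc 0 1) ?_ ?_ (Set.Icc_infinite one_pos)
  · have hval : ∀ t ∈ Set.Icc (0 : ℝ) 1, ∫ y, D y ∂(pG.map fun x => x + t • V x) =
        ∫ x, D x ∂pG + t * ∫ x, ‖V x‖ ∂pG := by
      intro t ht
      rw [integral_map (hYm t).aemeasurable hD.continuous.aestronglyMeasurable,
        ← integral_const_mul, ← integral_add (hD.integrable_of_integrable_norm hG)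
          (hVint.const_mul t)]
      refine integral_congr_ae (.of_forall fun x => ?_)
      have := hDt t ht x
      simp only
      linarith
    intro s hs t ht hst
    have h := congrArg (fun m : Measure _ => ∫ y, D y ∂m) hst
    simp only [hval s hs, hval t ht] at h
    exact mul_right_cancel₀ hpos.ne' (add_left_cancel h)
  · intro t ht
    refine ⟨_, hYm t, .of_forall fun x => ?_, rfl⟩
    rw [mem_dotArgmin_iff hD, hDt t ht x, add_sub_cancel_left, norm_smul,
      Real.norm_of_nonneg ht.1]

/-! ### Admissibility of the data distribution and conclusion. -/

theorem IsDotMapLaw.isDotLaw {n : ℕ} {D : EuclideanSpace ℝ (Fin n) → ℝ}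
    {pG q : Measure (EuclideanSpace ℝ (Fin n))} (h : IsDotMapLaw D pG q) : IsDotLaw D pG q := by
  obtain ⟨Y, hY, hmem, rfl⟩ := h
  refine ⟨Kernel.deterministic Y hY, inferInstance, ?_,
    (Measure.deterministic_comp_eq_map hY).symm⟩
  filter_upwards [hmem] with x hx
  rw [Kernel.deterministic_apply, ae_dirac_eq]
  exact hx

/-- The kernel is the conditional law of `y` given `x` under `π`. -/
theorem IsTransportPlan.isDotLaw {n : ℕ} {D : EuclideanSpace ℝ (Fin n) → ℝ}
    {pG pData : Measure (EuclideanSpace ℝ (Fin n))} [IsProbabilityMeasure pG]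
    {π : Measure (EuclideanSpace ℝ (Fin n) × EuclideanSpace ℝ (Fin n))}
    (hπ : IsTransportPlan π pG pData) (hmem : ∀ᵐ p ∂π, p.2 ∈ dotArgmin D p.1) :
    IsDotLaw D pG pData := by
  have : IsProbabilityMeasure π := hπ.isProbabilityMeasure
  have hfst : π.fst = pG := hπ.1
  have hdis : pG.compProd π.condKernel = π := by
    rw [← hfst]
    exact π.disintegrate π.condKernel
  refine ⟨π.condKernel, inferInstance, ?_, ?_⟩
  · rw [← hdis] at hmem
    exact Measure.ae_ae_of_ae_compProd hmem
  · rw [← Measure.snd_compProd, hdis]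
    exact hπ.2.symm

theorem theorem3 {n : ℕ}
    (pG pData : Measure (EuclideanSpace ℝ (Fin n)))
    [IsProbabilityMeasure pG] [IsProbabilityMeasure pData]
    (hG : Integrable (fun x => ‖x‖) pG) (hData : Integrable (fun x => ‖x‖) pData)
    (π : Measure (EuclideanSpace ℝ (Fin n) × EuclideanSpace ℝ (Fin n)))
    (hπ : IsOptimalPlan π pG pData)
    (D : EuclideanSpace ℝ (Fin n) → ℝ) (hD : IsOptimalCritic D pG pData)
    (hne : pData ≠ pG) :
    -- every point of the segment from `x` to its target `y` is a minimizer, and, apart from the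
    -- kink of the norm at `x`, a stationary point (at the end `y`: if `D` has a gradient there)
    (∀ᵐ p ∂π, ∀ z ∈ segment ℝ p.1 p.2,
      z ∈ dotArgmin D p.1 ∧
        (z ≠ p.1 → (z ≠ p.2 ∨ DifferentiableAt ℝ D z) →
          HasGradientAt (dotObjective D p.1) 0 z)) ∧
    -- the minimizer is not unique
    (¬ ∀ᵐ x ∂pG, (dotArgmin D x).Subsingleton) ∧
    -- there are infinitely many admissible distributions, even with single-valued DOT maps
    {q | IsDotLaw D pG q}.Infinite ∧
    {q | IsDotMapLaw D pG q}.Infinite ∧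
    -- the data distribution is one of them
    IsDotLaw D pG pData ∧
    -- and it comes from a single-valued DOT map as soon as the plan is given by a map
    (∀ T : EuclideanSpace ℝ (Fin n) → EuclideanSpace ℝ (Fin n), Measurable T →
      π = pG.map (fun x => (x, T x)) → IsDotMapLaw D pG pData) := by
  have hae := hD.ae_sub_eq_norm hG hData hπ
  have hmem : ∀ᵐ p ∂π, p.2 ∈ dotArgmin D p.1 := by
    filter_upwards [hae] with p hp
    rw [mem_dotArgmin_iff hD.1, hp, norm_sub_rev]
  obtain ⟨k, hk⟩ := exists_measure_dotDisplacements_nonempty_ne_zero hπ.1 hae hne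
  have hinf := infinite_setOf_isDotMapLaw hG hD.1 hk
  refine ⟨?_, ?_, hinf.mono fun q hq => hq.isDotLaw, hinf, hπ.1.isDotLaw hmem, ?_⟩
  · filter_upwards [hae] with p hp z hz
    rw [norm_sub_rev] at hp
    obtain ⟨h1, h2⟩ := sub_eq_norm_of_mem_segment hD.1 hp hz
    have hzmem : z ∈ dotArgmin D p.1 := (mem_dotArgmin_iff hD.1).2 h1
    refine ⟨hzmem, fun hzx hor => ?_⟩
    by_cases hzy : z = p.2
    · exact hasGradientAt_dotObjective_of_differentiableAt hzmem hzx
        (hor.resolve_left (not_not.2 hzy))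
    · exact hasGradientAt_dotObjective_of_ne hD.1 h1 h2 hzx hzy
  -- Since `x` always minimizes, uniqueness would force `y = x` for `π`-almost every pair.
  · intro hsub
    rw [← hπ.1.1] at hsub
    refine hne (hπ.1.eq_of_ae_eq ?_).symm
    filter_upwards [hmem, ae_of_ae_map measurable_fst.aemeasurable hsub] with p hp hs
    exact hs ((mem_dotArgmin_iff hD.1).2 (by simp)) hp
  · rintro T hT rfl
    have hm : Measurable fun x => (x, T x) := measurable_id.prodMk hT
    refine ⟨T, hT, ae_of_ae_map hm.aemeasurable hmem, ?_⟩
    rw [← hπ.1.2, Measure.map_map measurable_snd hm]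
    rfl
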